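/- Let $\epsilon$ be a primitive cube root of unity, let $\alpha \in \mathbb{Z}\setminus\{0,1\}$ be a cube-free integer (no cube of an integer other than $\pm 1$ divides $\alpha$), let $\sqrt[3]{\alpha}$ be any cube root of $\alpha$, and let $K = \mathbb{Q}(\epsilon, \sqrt[3]{\alpha})$. Let $p$ and $q$ be distinct (odd) primes with $p \equiv q \equiv 3 \pmod 4$ and Legendre symbol $\left(\frac{q}{p}\right) \neq 1$. Let $H_K(p,q)$ be the quaternion algebra over $K$ with basis $1, i, j, ij$ and relations $i^2 = p$, $j^2 = q$, $ij = -ji$. Then $H_K(p,q)$ is a division algebra if and only if $\left(\frac{-3}{p}\right) = 1$. -/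

import Mathlib

open scoped Quaternion IntermediateField

/-- A ring `A` is a division algebra if it is nonzero and, for all `a b` in `A` with `a ≠ 0`, the
equations `a * x = b` and `y * a = b` have unique solutions. -/
def IsDivisionAlgebra (A : Type*) [Ring A] : Prop :=
  Nontrivial A ∧ ∀ a b : A, a ≠ 0 → (∃! x : A, a * x = b) ∧ (∃! y : A, y * a = b)

/-- An integer is cube-free if no cube of a non-unit divides it. -/
def IsCubeFree (n : ℤ) : Prop :=
  ∀ d : ℤ, d ^ 3 ∣ n → IsUnit d

/-! The algebra is a division algebra exactly when its norm form `x² - py² - qz² + pqw²` is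
anisotropic over `K`, and the hypotheses force `q` to be a nonresidue mod `p`.

If `-3` is a nonzero square mod `p`, then `ℚ_p` contains the cube roots of unity, so `K` embeds in
`ℚ_p(∛α)`, of degree 1 or 3 over `ℚ_p`. The norm form is anisotropic over `ℚ_p`
(`Padic.normForm_anisotropic`), and Springer's argument carries this to the cubic extension.

Otherwise `3` is a square mod `p`, and Thue's lemma gives `p = 3w² - x²`. Over `ℚ(ε)` both `-3` is a
square and `-1 = ε² + ε⁴`, so `p` is a sum of two squares and `(p, -1)` splits. By Legendre `(p,
-q)` splits already over `ℚ`; multiplying the two solutions splits `(p, q)`. -/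

theorem isDivisionAlgebra_quaternionAlgebra {F : Type*} [Field F] {a b : F}
    (h : ∀ x y z w : F, x ^ 2 - a * y ^ 2 - b * z ^ 2 + a * b * w ^ 2 = 0 →
      x = 0 ∧ y = 0 ∧ z = 0 ∧ w = 0) : IsDivisionAlgebra ℍ[F, a, b] := by
  have key : ∀ u : ℍ[F, a, b], u ≠ 0 → ∃ v, u * v = 1 ∧ v * u = 1 := by
    intro u hu
    set n := u.re ^ 2 - a * u.imI ^ 2 - b * u.imJ ^ 2 + a * b * u.imK ^ 2 with hn
    have hn0 : n ≠ 0 := fun h0 => hu (by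
      obtain ⟨h1, h2, h3, h4⟩ := h _ _ _ _ h0
      ext <;> assumption)
    refine ⟨⟨u.re / n, -u.imI / n, -u.imJ / n, -u.imK / n⟩, ?_, ?_⟩ <;>
    · ext <;> simp <;> field_simp <;> rw [hn] <;> ring
  refine ⟨⟨0, 1, fun h01 => ?_⟩, fun u v hu => ?_⟩
  · simpa using congrArg QuaternionAlgebra.re h01
  · obtain ⟨u', h1, h2⟩ := key u hu
    refine ⟨⟨u' * v, by simp [← mul_assoc, h1], fun y hy => ?_⟩,
      ⟨v * u', by simp [mul_assoc, h2], fun y hy => ?_⟩⟩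
    · simp only at hy; rw [← hy, ← mul_assoc, h2, one_mul]
    · simp only at hy; rw [← hy, mul_assoc, h1, mul_one]

theorem not_isDivisionAlgebra_quaternionAlgebra {F : Type*} [Field F] {a b x y z : F}
    (h : x ^ 2 - a * y ^ 2 = b * z ^ 2) (h0 : ¬(x = 0 ∧ y = 0 ∧ z = 0)) :
    ¬IsDivisionAlgebra ℍ[F, a, b] := by
  rintro ⟨-, hdiv⟩
  have hu : (⟨x, y, z, 0⟩ : ℍ[F, a, b]) ≠ 0 := fun hu =>
    h0 ⟨congrArg QuaternionAlgebra.re hu, congrArg QuaternionAlgebra.imI hu,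
      congrArg QuaternionAlgebra.imJ hu⟩
  -- The conjugate times the element is its norm, here zero, so unique solvability kills the
  -- conjugate.
  have hv : (⟨x, -y, -z, 0⟩ : ℍ[F, a, b]) = 0 := by
    refine (hdiv _ 0 hu).1.unique (y₁ := ⟨x, -y, -z, 0⟩) (y₂ := 0) ?_ (mul_zero _)
    ext <;> simp
    · linear_combination h
    all_goals ring
  exact h0 ⟨congrArg QuaternionAlgebra.re hv, neg_eq_zero.1 (congrArg QuaternionAlgebra.imI hv),
    neg_eq_zero.1 (congrArg QuaternionAlgebra.imJ hv)⟩

/-! ### Springer's theorem for cubic extensions -/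

open Polynomial in
/-- Springer's theorem for a quaternion norm form and a cubic extension, in terms of polynomials. -/
theorem eq_zero_of_irreducible_cubic_dvd_normForm {k : Type*} [Field k] [Infinite k] {a b : k}
    (h : ∀ x y z w : k, x ^ 2 - a * y ^ 2 - b * z ^ 2 + a * b * w ^ 2 = 0 →
      x = 0 ∧ y = 0 ∧ z = 0 ∧ w = 0)
    {m : k[X]} (hm : Irreducible m) (hdeg : m.natDegree = 3) {f g r s : k[X]}
    (hf : f.natDegree ≤ 2) (hg : g.natDegree ≤ 2) (hr : r.natDegree ≤ 2) (hs : s.natDegree ≤ 2)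
    (hdvd : m ∣ f ^ 2 - C a * g ^ 2 - C b * r ^ 2 + C (a * b) * s ^ 2) :
    f = 0 ∧ g = 0 ∧ r = 0 ∧ s = 0 := by
  have haniso : ∀ f g r s : k[X], f ^ 2 - C a * g ^ 2 - C b * r ^ 2 + C (a * b) * s ^ 2 = 0 →
      f = 0 ∧ g = 0 ∧ r = 0 ∧ s = 0 := by
    intro f g r s h0
    have := fun x => h (f.eval x) (g.eval x) (r.eval x) (s.eval x) (by
      simpa using congrArg (eval x) h0)
    refine ⟨?_, ?_, ?_, ?_⟩ <;> refine funext fun x => ?_ <;> simp [this x]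
  have hbound : ∀ (d : ℕ) (f g r s : k[X]), f.natDegree ≤ d → g.natDegree ≤ d →
      r.natDegree ≤ d → s.natDegree ≤ d →
      (f ^ 2 - C a * g ^ 2 - C b * r ^ 2 + C (a * b) * s ^ 2).natDegree ≤ 2 * d := by
    intro d f g r s hf hg hr hs
    have e : ∀ u : k[X], u.natDegree ≤ d → (u ^ 2).natDegree ≤ 2 * d :=
      fun u hu => natDegree_pow_le_of_le 2 hu
    have e' : ∀ (t : k) (u : k[X]), u.natDegree ≤ d → (C t * u ^ 2).natDegree ≤ 2 * d :=
      fun t u hu => (natDegree_C_mul_le _ _).trans (e u hu)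
    have h1 := natDegree_sub_le_of_le (e f hf) (e' a g hg)
    rw [max_self] at h1
    have h2 := natDegree_sub_le_of_le h1 (e' b r hr)
    rw [max_self] at h2
    exact natDegree_add_le_of_degree_le h2 (e' (a * b) s hs)
  have hlinear : ∀ f g r s : k[X], f.natDegree ≤ 1 → g.natDegree ≤ 1 →
      r.natDegree ≤ 1 → s.natDegree ≤ 1 →
      m ∣ f ^ 2 - C a * g ^ 2 - C b * r ^ 2 + C (a * b) * s ^ 2 →
      f = 0 ∧ g = 0 ∧ r = 0 ∧ s = 0 := by
    intro f g r s hf hg hr hs hd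
    refine haniso f g r s (eq_zero_of_dvd_of_natDegree_lt hd ?_)
    have := hbound 1 f g r s hf hg hr hs
    omega
  by_contra hne
  obtain ⟨c, hc⟩ := hdvd
  have hc0 : c ≠ 0 := by
    rintro rfl
    exact hne (haniso _ _ _ _ (by rw [hc, mul_zero]))
  have hcdeg : c.natDegree ≤ 1 := by
    have h1 := hbound 2 f g r s hf hg hr hs
    rw [hc, natDegree_mul hm.ne_zero hc0] at h1
    omega
  -- The cofactor `c` has degree at most 1. If it is constant, the form vanishes at the coefficients
  -- of `X²`; if it is linear, the form vanishes at the values at its root. Either way anisotropy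
  -- reduces to degree at most 1.
  rcases Nat.lt_or_ge c.natDegree 1 with hlt | hge
  · have hsq : ∀ u : k[X], u.natDegree ≤ 2 → (u ^ 2).coeff 4 = u.coeff 2 ^ 2 := fun u hu =>
      coeff_pow_of_natDegree_le hu
    have h4 : (m * c).coeff 4 = 0 := coeff_eq_zero_of_natDegree_lt (by
      rw [natDegree_mul hm.ne_zero hc0]; omega)
    rw [← hc] at h4
    simp only [coeff_add, coeff_sub, coeff_C_mul, hsq _ hf, hsq _ hg, hsq _ hr, hsq _ hs] at h4
    obtain ⟨h1, h2, h3, h4⟩ := h _ _ _ _ h4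
    have e : ∀ u : k[X], u.natDegree ≤ 2 → u.coeff 2 = 0 → u.natDegree ≤ 1 := by
      intro u hu hu2
      refine natDegree_le_iff_coeff_eq_zero.2 fun N hN => ?_
      rcases (show 2 ≤ N from hN).eq_or_lt with rfl | hN'
      · exact hu2
      · exact coeff_eq_zero_of_natDegree_lt (by omega)
    exact hne (hlinear _ _ _ _ (e _ hf h1) (e _ hg h2) (e _ hr h3) (e _ hs h4) ⟨c, hc⟩)
  · obtain ⟨x, hx⟩ := exists_root_of_degree_eq_one (p := c) (by
      rw [degree_eq_natDegree hc0]; norm_cast; omega)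
    have hev := congrArg (eval x) hc
    rw [eval_mul, hx.eq_zero, mul_zero] at hev
    obtain ⟨h1, h2, h3, h4⟩ := h (f.eval x) (g.eval x) (r.eval x) (s.eval x) (by simpa using hev)
    have e : ∀ u : k[X], u.natDegree ≤ 2 → u.eval x = 0 →
        ∃ v, u = (X - C x) * v ∧ v.natDegree ≤ 1 := by
      intro u hu hux
      obtain ⟨v, rfl⟩ := dvd_iff_isRoot.2 hux
      refine ⟨v, rfl, ?_⟩
      rcases eq_or_ne v 0 with rfl | hv
      · simp
      · rw [natDegree_mul (X_sub_C_ne_zero x) hv, natDegree_X_sub_C] at hu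
        omega
    obtain ⟨f, rfl, hf'⟩ := e _ hf h1
    obtain ⟨g, rfl, hg'⟩ := e _ hg h2
    obtain ⟨r, rfl, hr'⟩ := e _ hr h3
    obtain ⟨s, rfl, hs'⟩ := e _ hs h4
    have hd : m ∣ (X - C x) ^ 2 * (f ^ 2 - C a * g ^ 2 - C b * r ^ 2 + C (a * b) * s ^ 2) :=
      ⟨c, by rw [← hc]; ring⟩
    rcases hm.prime.dvd_or_dvd hd with hd | hd
    · have := natDegree_le_of_dvd (hm.prime.dvd_of_dvd_pow hd) (X_sub_C_ne_zero x)
      rw [natDegree_X_sub_C] at this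
      omega
    · obtain ⟨rfl, rfl, rfl, rfl⟩ := hlinear _ _ _ _ hf' hg' hr' hs' hd
      simp at hne

open Polynomial in
theorem normForm_anisotropic_adjoin_of_pow_three {k Ω : Type*} [Field k] [Infinite k] [Field Ω]
    [Algebra k Ω] {a b : k}
    (h : ∀ x y z w : k, x ^ 2 - a * y ^ 2 - b * z ^ 2 + a * b * w ^ 2 = 0 →
      x = 0 ∧ y = 0 ∧ z = 0 ∧ w = 0)
    {ζ : k} (hζ : IsPrimitiveRoot ζ 3) {c : k} (hc : c ≠ 0) {θ : Ω}
    (hθ : θ ^ 3 = algebraMap k Ω c) {x y z w : Ω}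
    (hx : x ∈ k⟮θ⟯) (hy : y ∈ k⟮θ⟯) (hz : z ∈ k⟮θ⟯) (hw : w ∈ k⟮θ⟯)
    (h0 : x ^ 2 - algebraMap k Ω a * y ^ 2 - algebraMap k Ω b * z ^ 2
      + algebraMap k Ω (a * b) * w ^ 2 = 0) :
    x = 0 ∧ y = 0 ∧ z = 0 ∧ w = 0 := by
  -- As `k` contains the cube roots of unity, `c` being a cube puts `θ` in `k`; otherwise `X³ - c`
  -- is irreducible.
  by_cases hroot : ∃ t : k, t ^ 3 = c
  · obtain ⟨t, rfl⟩ := hroot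
    have ht : algebraMap k Ω t ≠ 0 := by
      simpa using fun h => hc (by simp [h])
    have h1 : (θ / algebraMap k Ω t) ^ 3 = 1 := by
      rw [div_pow, hθ, map_pow, div_self (pow_ne_zero 3 ht)]
    obtain ⟨i, -, hi⟩ := (hζ.map_of_injective (algebraMap k Ω).injective).eq_pow_of_pow_eq_one h1
    have hbot : k⟮θ⟯ = ⊥ := by
      rw [IntermediateField.adjoin_simple_eq_bot_iff, IntermediateField.mem_bot]
      refine ⟨ζ ^ i * t, ?_⟩
      rw [map_mul, map_pow, hi, div_mul_cancel₀ _ ht]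
    rw [hbot, IntermediateField.mem_bot] at hx hy hz hw
    obtain ⟨x, rfl⟩ := hx
    obtain ⟨y, rfl⟩ := hy
    obtain ⟨z, rfl⟩ := hz
    obtain ⟨w, rfl⟩ := hw
    obtain ⟨rfl, rfl, rfl, rfl⟩ := h x y z w ((algebraMap k Ω).injective (by simpa using h0))
    simp
  · push Not at hroot
    have hirr : Irreducible (X ^ 3 - C c : k[X]) :=
      X_pow_sub_C_irreducible_of_prime Nat.prime_three hroot
    have hmonic : (X ^ 3 - C c : k[X]).Monic := monic_X_pow_sub_C c three_ne_zero
    have hdeg : (X ^ 3 - C c : k[X]).natDegree = 3 := natDegree_X_pow_sub_C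
    have hθ0 : aeval θ (X ^ 3 - C c : k[X]) = 0 := by simp [hθ]
    have e : ∀ u ∈ k⟮θ⟯, ∃ f : k[X], f.natDegree ≤ 2 ∧ aeval θ f = u := by
      intro u hu
      have hint : IsIntegral k θ := ⟨_, hmonic, hθ0⟩
      rw [← IntermediateField.mem_toSubalgebra,
        IntermediateField.adjoin_simple_toSubalgebra_of_isAlgebraic hint.isAlgebraic,
        Algebra.adjoin_singleton_eq_range_aeval] at hu
      obtain ⟨f, rfl⟩ := hu
      refine ⟨f %ₘ (X ^ 3 - C c), ?_, ?_⟩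
      · have := natDegree_modByMonic_lt f hmonic (fun h => by simp [h] at hdeg)
        omega
      · exact aeval_modByMonic_eq_self_of_root hθ0
    obtain ⟨f, hf, rfl⟩ := e x hx
    obtain ⟨g, hg, rfl⟩ := e y hy
    obtain ⟨r, hr, rfl⟩ := e z hz
    obtain ⟨s, hs, rfl⟩ := e w hw
    obtain ⟨rfl, rfl, rfl, rfl⟩ := eq_zero_of_irreducible_cubic_dvd_normForm h hirr hdeg hf hg hr hs
      (by
        rw [minpoly.eq_of_irreducible_of_monic hirr hθ0 hmonic]
        exact minpoly.dvd k θ (by simpa using h0))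
    simp

/-! ### Small solutions of congruences by pigeonhole -/

theorem Int.sq_le_of_natCast_le_sqrt {n a b : ℕ} (ha : a ≤ n.sqrt) (hb : b ≤ n.sqrt) :
    ((a : ℤ) - b) ^ 2 ≤ n := by
  have h : |(a : ℤ) - b| ≤ n.sqrt := abs_le.2 ⟨by omega, by omega⟩
  calc ((a : ℤ) - b) ^ 2 = |(a : ℤ) - b| ^ 2 := (sq_abs _).symm
    _ ≤ (n.sqrt : ℤ) ^ 2 := by gcongr
    _ ≤ n := mod_cast Nat.sqrt_le' n

theorem Nat.Prime.int_sq_ne {p : ℕ} (hp : p.Prime) (x : ℤ) : x ^ 2 ≠ p := fun h =>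
  (Nat.prime_iff_prime_int.1 hp).irreducible.not_isSquare ⟨x, by rw [← h, sq]⟩

/-- A two-variable form of Thue's lemma. -/
theorem ZMod.exists_small_eq_mul (p : ℕ) [NeZero p] (s : ZMod p) :
    ∃ x w : ℤ, ¬(x = 0 ∧ w = 0) ∧ x ^ 2 ≤ p ∧ w ^ 2 ≤ p ∧ (x : ZMod p) = s * w := by
  let S := Finset.range (p.sqrt + 1) ×ˢ Finset.range (p.sqrt + 1)
  let φ : ℕ × ℕ → ZMod p := fun v => v.1 - s * v.2
  obtain ⟨⟨x₁, w₁⟩, h₁, ⟨x₂, w₂⟩, h₂, hne, heq⟩ :=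
    Finset.exists_ne_map_eq_of_card_lt_of_maps_to (s := S) (t := Finset.univ) (f := φ)
      (by simpa [S, ZMod.card] using Nat.lt_succ_sqrt p) (fun _ _ => Finset.mem_univ _)
  simp only [S, Finset.mem_product, Finset.mem_range, Nat.lt_succ_iff] at h₁ h₂
  refine ⟨(x₁ : ℤ) - x₂, (w₁ : ℤ) - w₂, ?_, Int.sq_le_of_natCast_le_sqrt h₁.1 h₂.1,
    Int.sq_le_of_natCast_le_sqrt h₁.2 h₂.2, ?_⟩
  · rintro ⟨hx, hw⟩
    exact hne (Prod.ext (by simp only; omega) (by simp only; omega))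
  · simp only [φ] at heq
    push_cast
    linear_combination heq

theorem exists_eq_three_mul_sq_sub_sq {p : ℕ} [hp : Fact p.Prime] (hp4 : p % 4 = 3)
    (h3 : IsSquare (3 : ZMod p)) : ∃ x w : ℤ, (p : ℤ) = 3 * w ^ 2 - x ^ 2 := by
  obtain ⟨s, hs⟩ := h3
  obtain ⟨x, w, hne, hx, hw, h⟩ := ZMod.exists_small_eq_mul p s
  have hdvd : (p : ℤ) ∣ x ^ 2 - 3 * w ^ 2 := by
    rw [← ZMod.intCast_zmod_eq_zero_iff_dvd]
    push_cast
    rw [h, hs]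
    ring
  obtain ⟨m, hm⟩ := hdvd
  have hp0 : (0 : ℤ) < p := mod_cast hp.out.pos
  have hx' := (hp.out.int_sq_ne x).lt_of_le hx
  have hw' := (hp.out.int_sq_ne w).lt_of_le hw
  have hm1 : m < 1 := by nlinarith [sq_nonneg w]
  have hm2 : -3 < m := by nlinarith [sq_nonneg x]
  -- Here `m` is -2, -1 or 0: the first fails mod 8, the last would make 3 a rational square.
  interval_cases m
  · exfalso
    have e : x ^ 2 - 3 * w ^ 2 = -2 * p := by rw [hm]; ring
    have h8 : (x ^ 2 - 3 * w ^ 2) % 8 = 2 := by omega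
    have hx8 : x % 8 = 0 ∨ x % 8 = 1 ∨ x % 8 = 2 ∨ x % 8 = 3 ∨ x % 8 = 4 ∨ x % 8 = 5 ∨ x % 8 = 6 ∨
      x % 8 = 7 := by omega
    have hw8 : w % 8 = 0 ∨ w % 8 = 1 ∨ w % 8 = 2 ∨ w % 8 = 3 ∨ w % 8 = 4 ∨ w % 8 = 5 ∨ w % 8 = 6 ∨
      w % 8 = 7 := by omega
    rw [Int.sub_emod, Int.mul_emod, pow_two, pow_two, Int.mul_emod x, Int.mul_emod w] at h8
    rcases hx8 with h | h | h | h | h | h | h | h <;>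
      rcases hw8 with h' | h' | h' | h' | h' | h' | h' | h' <;> simp [h, h'] at h8
  · exact ⟨x, w, by linarith⟩
  · exfalso
    have hw0 : w ≠ 0 := by
      rintro rfl
      exact hne ⟨by simpa using hm, rfl⟩
    obtain ⟨k, rfl⟩ := (Int.pow_dvd_pow_iff two_ne_zero).1
      (show w ^ 2 ∣ x ^ 2 from ⟨3, by linarith⟩)
    refine Nat.prime_three.int_sq_ne k (mul_left_cancel₀ (pow_ne_zero 2 hw0) ?_)
    push_cast
    linarith

/-- A case of Legendre's theorem on ternary quadratic forms. -/
theorem exists_sq_sub_mul_sq_add_mul_sq_eq_zero {p q : ℕ} [hp : Fact p.Prime] [hq : Fact q.Prime]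
    (hpq : p ≠ q) (hs : IsSquare (-q : ZMod p)) (ht : IsSquare (p : ZMod q)) :
    ∃ x y z : ℤ, ¬(x = 0 ∧ y = 0 ∧ z = 0) ∧ x ^ 2 - p * y ^ 2 + q * z ^ 2 = 0 := by
  obtain ⟨s, hs⟩ := hs
  obtain ⟨t, ht⟩ := ht
  let S := Finset.range ((p * q).sqrt + 1) ×ˢ Finset.range (q.sqrt + 1) ×ˢ Finset.range (p.sqrt + 1)
  let φ : ℕ × ℕ × ℕ → ZMod p × ZMod q := fun v => (v.1 + s * v.2.2, v.1 + t * v.2.1)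
  have hcard : (Finset.univ : Finset (ZMod p × ZMod q)).card < S.card := by
    simp only [S, Finset.card_product, Finset.card_range, Finset.card_univ, Fintype.card_prod,
      ZMod.card]
    refine lt_of_pow_lt_pow_left₀ 2 (Nat.zero_le _) ?_
    have h1 := Nat.lt_succ_sqrt' (p * q)
    have h2 := Nat.lt_succ_sqrt' q
    have h3 := Nat.lt_succ_sqrt' p
    calc (p * q) ^ 2 = (p * q) * (q * p) := by ring
      _ < ((p * q).sqrt + 1) ^ 2 * ((q.sqrt + 1) ^ 2 * (p.sqrt + 1) ^ 2) := by gcongr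
      _ = _ := by ring
  obtain ⟨⟨x₁, y₁, z₁⟩, h₁, ⟨x₂, y₂, z₂⟩, h₂, hne, heq⟩ :=
    Finset.exists_ne_map_eq_of_card_lt_of_maps_to (f := φ) hcard (fun _ _ => Finset.mem_univ _)
  simp only [S, Finset.mem_product, Finset.mem_range, Nat.lt_succ_iff] at h₁ h₂
  simp only [φ, Prod.mk.injEq] at heq
  obtain ⟨x, hx⟩ : ∃ x : ℤ, x = (x₁ : ℤ) - x₂ := ⟨_, rfl⟩
  obtain ⟨y, hy⟩ : ∃ y : ℤ, y = (y₁ : ℤ) - y₂ := ⟨_, rfl⟩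
  obtain ⟨z, hz⟩ : ∃ z : ℤ, z = (z₁ : ℤ) - z₂ := ⟨_, rfl⟩
  have hxb : x ^ 2 ≤ (p : ℤ) * q := by
    rw [hx]; exact_mod_cast Int.sq_le_of_natCast_le_sqrt h₁.1 h₂.1
  have hyb : y ^ 2 ≤ q := hy ▸ Int.sq_le_of_natCast_le_sqrt h₁.2.1 h₂.2.1
  have hzb : z ^ 2 ≤ p := hz ▸ Int.sq_le_of_natCast_le_sqrt h₁.2.2 h₂.2.2
  have hyb := (hq.out.int_sq_ne y).lt_of_le hyb
  have hzb := (hp.out.int_sq_ne z).lt_of_le hzb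
  have hne' : ¬(x = 0 ∧ y = 0 ∧ z = 0) := by
    rintro ⟨rfl, rfl, rfl⟩
    refine hne ?_
    simp only [Prod.mk.injEq]
    omega
  have hdp : (p : ℤ) ∣ x ^ 2 - p * y ^ 2 + q * z ^ 2 := by
    rw [← ZMod.intCast_zmod_eq_zero_iff_dvd]
    have e : (x : ZMod p) = -(s * z) := by
      rw [hx, hz]; push_cast; linear_combination heq.1
    push_cast
    rw [e, CharP.cast_eq_zero]
    linear_combination -(z : ZMod p) ^ 2 * hs
  have hdq : (q : ℤ) ∣ x ^ 2 - p * y ^ 2 + q * z ^ 2 := by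
    rw [← ZMod.intCast_zmod_eq_zero_iff_dvd]
    have e : (x : ZMod q) = -(t * y) := by
      rw [hx, hy]; push_cast; linear_combination heq.2
    push_cast
    rw [e, CharP.cast_eq_zero (ZMod q) q]
    linear_combination -(y : ZMod q) ^ 2 * ht
  have hcop : IsCoprime (p : ℤ) q := Nat.isCoprime_iff_coprime.2
    ((Nat.coprime_primes hp.out hq.out).2 hpq)
  obtain ⟨m, hm⟩ := hcop.mul_dvd hdp hdq
  have hp0 : (0 : ℤ) < p := mod_cast hp.out.pos
  have hq0 : (0 : ℤ) < q := mod_cast hq.out.pos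
  have hpq0 : (0 : ℤ) < p * q := mul_pos hp0 hq0
  have hm1 : -1 < m := by
    have := mul_lt_mul_of_pos_left hyb hp0
    nlinarith [sq_nonneg x, mul_nonneg hq0.le (sq_nonneg z)]
  have hm2 : m < 2 := by
    have := mul_lt_mul_of_pos_left hzb hq0
    nlinarith [mul_nonneg hp0.le (sq_nonneg y)]
  interval_cases m
  · exact ⟨x, y, z, hne', by rw [hm, mul_zero]⟩
  -- Now `x² + qz² = p(y² + q)`. Multiplying by `y² + q`, the norm of `y + √-q`, makes the right
  -- side `p` times a square.
  · refine ⟨x * y - q * z, y ^ 2 + q, x + y * z, fun h => ?_, ?_⟩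
    · nlinarith [sq_nonneg y, h.2.1]
    · linear_combination (y ^ 2 + (q : ℤ)) * hm

/-! ### The norm form over `ℚ_p` -/

/-- No cancellation can occur: for `‖x‖ = ‖z‖ ≠ 0` it would make `q` the square of the residue of `x
/ z`; for unequal norms the larger term dominates. -/
theorem Padic.norm_sq_sub_mul_sq_of_nonresidue {p : ℕ} [hp : Fact p.Prime] {q : ℕ}
    (hq : legendreSym p q = -1) (x z : ℚ_[p]) :
    ‖x ^ 2 - q * z ^ 2‖ = max ‖x‖ ‖z‖ ^ 2 := by
  have hnd : ¬ p ∣ q := by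
    rw [← ZMod.natCast_eq_zero_iff]
    intro h
    have := (legendreSym.eq_zero_iff p q).2 (by exact_mod_cast h)
    omega
  have hq1 : ‖(q : ℚ_[p])‖ = 1 := by
    rw [Padic.norm_natCast_eq_one_iff]
    exact (Nat.Prime.coprime_iff_not_dvd hp.out).2 hnd
  rcases lt_trichotomy ‖x‖ ‖z‖ with h | h | h
  · have h2 : ‖x ^ 2‖ < ‖(q : ℚ_[p]) * z ^ 2‖ := by
      rw [norm_mul, hq1, one_mul, norm_pow, norm_pow]; gcongr
    rw [sub_eq_add_neg, Padic.add_eq_max_of_ne (by rw [norm_neg]; exact h2.ne), norm_neg, max_eq_right h2.le,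
      max_eq_right h.le, norm_mul, hq1, one_mul, norm_pow]
  · rw [h, max_self]
    rcases eq_or_ne z 0 with rfl | hz
    · rw [norm_zero, norm_eq_zero] at h
      simp [h]
    · have hu : ‖x / z‖ ≤ 1 := by rw [norm_div, h, div_self (norm_ne_zero_iff.2 hz)]
      let u : ℤ_[p] := ⟨x / z, hu⟩
      have hn : ‖u ^ 2 - (q : ℤ_[p])‖ = 1 := by
        refine le_antisymm (PadicInt.norm_le_one _) (not_lt.1 fun hlt => ?_)
        rw [PadicInt.norm_lt_one_iff_dvd] at hlt
        have h0 := (map_dvd (PadicInt.toZMod (p := p)) hlt)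
        rw [map_natCast, CharP.cast_eq_zero, zero_dvd_iff, map_sub, map_pow, map_natCast,
          sub_eq_zero] at h0
        exact (legendreSym.eq_neg_one_iff p).1 hq ⟨PadicInt.toZMod u, by
          rw [← sq, h0]; simp⟩
      have e : x ^ 2 - q * z ^ 2 = ((u ^ 2 - (q : ℤ_[p]) : ℤ_[p]) : ℚ_[p]) * z ^ 2 := by
        have hxz : (u : ℚ_[p]) = x / z := rfl
        rw [PadicInt.coe_sub, PadicInt.coe_pow, PadicInt.coe_natCast, hxz]
        field_simp
      rw [e, norm_mul, norm_pow]
      have : ‖((u ^ 2 - (q : ℤ_[p]) : ℤ_[p]) : ℚ_[p])‖ = 1 := hn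
      rw [this, one_mul]
  · have h2 : ‖(q : ℚ_[p]) * z ^ 2‖ < ‖x ^ 2‖ := by
      rw [norm_mul, hq1, one_mul, norm_pow, norm_pow]; gcongr
    rw [sub_eq_add_neg, Padic.add_eq_max_of_ne (by rw [norm_neg]; exact h2.ne'), norm_neg, max_eq_left h2.le,
      max_eq_left h.le, norm_pow]

theorem Padic.norm_ne_sqrt {p : ℕ} [hp : Fact p.Prime] {x y : ℚ_[p]} (hy : y ≠ 0) :
    ‖x‖ ^ 2 ≠ ‖(p : ℚ_[p])‖ * ‖y‖ ^ 2 := by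
  intro h
  have hp0 : (p : ℚ_[p]) ≠ 0 := by exact_mod_cast hp.out.ne_zero
  have hx : x ≠ 0 := by
    rintro rfl
    simp [hy, hp.out.ne_zero] at h
  rw [← norm_pow, ← norm_pow, ← norm_mul, Padic.norm_eq_zpow_neg_valuation (pow_ne_zero 2 hx),
    Padic.norm_eq_zpow_neg_valuation (mul_ne_zero hp0 (pow_ne_zero 2 hy)),
    Padic.valuation_mul hp0 (pow_ne_zero 2 hy), Padic.valuation_pow, Padic.valuation_pow,
    Padic.valuation_p] at h
  have := zpow_right_injective₀ (a := (p : ℝ)) (by exact_mod_cast hp.out.pos)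
    (by exact_mod_cast hp.out.ne_one) h
  push_cast at this
  omega

/-- In `x² - qz² = p(y² - qw²)` a nonzero left side has even valuation and a nonzero right side odd
valuation, so both vanish. -/
theorem Padic.normForm_anisotropic {p : ℕ} [hp : Fact p.Prime] {q : ℕ}
    (hq : legendreSym p q = -1) (x y z w : ℚ_[p])
    (h : x ^ 2 - p * y ^ 2 - q * z ^ 2 + p * q * w ^ 2 = 0) :
    x = 0 ∧ y = 0 ∧ z = 0 ∧ w = 0 := by
  have e : x ^ 2 - q * z ^ 2 = p * (y ^ 2 - q * w ^ 2) := by linear_combination h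
  have hn := congrArg norm e
  rw [norm_mul, norm_sq_sub_mul_sq_of_nonresidue hq, norm_sq_sub_mul_sq_of_nonresidue hq] at hn
  have hmax : ∀ a b : ℚ_[p], ∃ c, max ‖a‖ ‖b‖ = ‖c‖ := fun a b =>
    (max_choice ‖a‖ ‖b‖).elim (fun h => ⟨a, h⟩) (fun h => ⟨b, h⟩)
  have hle : ∀ a b : ℚ_[p], max ‖a‖ ‖b‖ = 0 → a = 0 ∧ b = 0 := fun a b h =>
    ⟨norm_le_zero_iff.1 (h ▸ le_max_left _ _), norm_le_zero_iff.1 (h ▸ le_max_right _ _)⟩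
  obtain ⟨c, hc⟩ := hmax x z
  obtain ⟨d, hd⟩ := hmax y w
  have hd0 : d = 0 := by
    by_contra hd0
    rw [hc, hd] at hn
    exact norm_ne_sqrt hd0 hn
  rw [hd0, norm_zero] at hd
  rw [hd] at hn
  have hc0 : max ‖x‖ ‖z‖ = 0 := by simpa using hn
  exact ⟨(hle _ _ hc0).1, (hle _ _ hd).1, (hle _ _ hc0).2, (hle _ _ hd).2⟩

open Polynomial in
theorem PadicInt.exists_sq_eq_neg_three {p : ℕ} [hp : Fact p.Prime] (hp2 : p ≠ 2)
    (h : legendreSym p (-3) = 1) : ∃ s : ℤ_[p], s ^ 2 = -3 := by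
  have h3 : ((-3 : ℤ) : ZMod p) ≠ 0 := fun h0 => by
    rw [(legendreSym.eq_zero_iff p _).2 h0] at h
    exact zero_ne_one h
  obtain ⟨a, ha⟩ := (legendreSym.eq_one_iff p h3).1 h
  obtain ⟨a, rfl⟩ := ZMod.intCast_surjective a
  have ha0 : (a : ZMod p) ≠ 0 := fun h0 => h3 (by rw [ha, h0, mul_zero])
  have h20 : (2 : ZMod p) ≠ 0 := by
    exact Ring.two_ne_zero (by rwa [ZMod.ringChar_zmod_n])
  have hder : ‖(2 * a : ℤ_[p])‖ = 1 := by
    have e : (2 * a : ℤ_[p]) = ((2 * a : ℤ) : ℤ_[p]) := by push_cast; rfl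
    rw [e]
    refine le_antisymm (PadicInt.norm_le_one _) (not_lt.1 fun hlt => ?_)
    rw [PadicInt.norm_int_lt_one_iff_dvd, ← ZMod.intCast_zmod_eq_zero_iff_dvd] at hlt
    push_cast at hlt
    exact mul_ne_zero h20 ha0 hlt
  have hval : ‖(a ^ 2 + 3 : ℤ_[p])‖ < 1 := by
    have e : (a ^ 2 + 3 : ℤ_[p]) = ((a ^ 2 + 3 : ℤ) : ℤ_[p]) := by push_cast; rfl
    rw [e, PadicInt.norm_int_lt_one_iff_dvd, ← ZMod.intCast_zmod_eq_zero_iff_dvd]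
    push_cast at ha ⊢
    linear_combination -ha
  obtain ⟨s, hs, -⟩ := hensels_lemma (p := p) (R := ℤ) (F := X ^ 2 + 3) (a := (a : ℤ_[p])) (by
    have h1 : aeval (a : ℤ_[p]) (X ^ 2 + 3 : ℤ[X]) = a ^ 2 + 3 := by
      simp only [map_add, map_pow, aeval_X, map_ofNat]
    have h2 : aeval (a : ℤ_[p]) (derivative (X ^ 2 + 3 : ℤ[X])) = 2 * a := by
      rw [derivative_add, derivative_X_sq, derivative_ofNat, add_zero, map_mul, aeval_X, aeval_C,
        map_ofNat]
    rw [h1, h2, hder, one_pow]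
    exact hval)
  refine ⟨s, ?_⟩
  simp only [map_add, map_pow, aeval_X, map_ofNat] at hs
  linear_combination hs

theorem Padic.exists_isPrimitiveRoot_three {p : ℕ} [hp : Fact p.Prime] (hp2 : p ≠ 2)
    (h : legendreSym p (-3) = 1) : ∃ ζ : ℚ_[p], IsPrimitiveRoot ζ 3 := by
  obtain ⟨s, hs⟩ := PadicInt.exists_sq_eq_neg_three hp2 h
  have hs : (s : ℚ_[p]) ^ 2 = -3 := by exact_mod_cast congrArg (fun t : ℤ_[p] => (t : ℚ_[p])) hs
  have h1 : ((-1 + s) / 2 : ℚ_[p]) ^ 2 + (-1 + s) / 2 + 1 = 0 := by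
    field_simp
    linear_combination hs
  refine ⟨(-1 + s) / 2, ?_⟩
  rw [← Polynomial.isRoot_cyclotomic_iff, Polynomial.cyclotomic_three]
  simpa using h1

/-! ### Splitting, local embedding and conclusion -/

/-- Over a field with a primitive cube root of unity, the algebra `(p, q)` over `ℚ` splits if `p` does not
split in `ℚ(√-3)`. -/
theorem exists_sq_sub_mul_sq_eq_mul_sq {F : Type*} [Field F] [CharZero F] {ε : F}
    (hε : IsPrimitiveRoot ε 3) {p q : ℕ} [hp : Fact p.Prime] [hq : Fact q.Prime] (hpq : p ≠ q)
    (hp4 : p % 4 = 3) (hq4 : q % 4 = 3) (hqp : legendreSym p (q : ℤ) = -1)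
    (h : legendreSym p (-3) ≠ 1) :
    ∃ x y z : F, ¬(x = 0 ∧ y = 0 ∧ z = 0) ∧ x ^ 2 - p * y ^ 2 = q * z ^ 2 := by
  have hp2 : p ≠ 2 := by omega
  have hχ : ZMod.χ₄ p = -1 := ZMod.χ₄_nat_three_mod_four hp4
  have h3 : IsSquare (3 : ZMod p) := by
    -- This is the case `p = 3`, where the symbol is 0.
    by_cases h0 : ((3 : ℤ) : ZMod p) = 0
    · push_cast at h0
      exact h0 ▸ IsSquare.zero
    · have h1 : legendreSym p (-3) = -legendreSym p 3 := by
        rw [legendreSym.at_neg hp2, hχ, neg_one_mul]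
      have h2 : legendreSym p 3 = 1 := by
        rcases legendreSym.eq_one_or_neg_one p h0 with h2 | h2
        · exact h2
        · exact absurd (by rw [h1, h2, neg_neg]) h
      simpa using (legendreSym.eq_one_iff p h0).1 h2
  have hs : IsSquare (-q : ZMod p) := by
    have h1 : legendreSym p (-(q : ℤ)) = 1 := by
      rw [legendreSym.at_neg hp2, hχ, hqp, neg_one_mul, neg_neg]
    have h0 : ((-(q : ℤ) : ℤ) : ZMod p) ≠ 0 := fun h0 => by
      rw [(legendreSym.eq_zero_iff p _).2 h0] at h1
      exact zero_ne_one h1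
    simpa using (legendreSym.eq_one_iff p h0).1 h1
  have ht : IsSquare (p : ZMod q) := by
    have h1 : legendreSym q (p : ℤ) = 1 := by
      rw [legendreSym.quadratic_reciprocity_three_mod_four hp4 hq4, hqp, neg_neg]
    have h0 : ((p : ℤ) : ZMod q) ≠ 0 := fun h0 => by
      rw [(legendreSym.eq_zero_iff q _).2 h0] at h1
      exact zero_ne_one h1
    simpa using (legendreSym.eq_one_iff q h0).1 h1
  have hε1 : 1 + ε + ε ^ 2 = 0 := by
    have := hε.isRoot_cyclotomic (by norm_num)
    rw [Polynomial.cyclotomic_three] at this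
    simp only [Polynomial.IsRoot.def, Polynomial.eval_add, Polynomial.eval_pow,
      Polynomial.eval_X, Polynomial.eval_one] at this
    linear_combination this
  obtain ⟨u, v, huv⟩ := exists_eq_three_mul_sq_sub_sq hp4 h3
  obtain ⟨A, B, hAB⟩ : ∃ A B : F, (p : F) = A ^ 2 + B ^ 2 := by
    have huv' : (p : F) = 3 * (v : F) ^ 2 - (u : F) ^ 2 := by
      exact_mod_cast congrArg (Int.cast : ℤ → F) huv
    -- Two-squares identity applied to `-p = u² + ((1 + 2ε)v)²` and `-1 = ε² + (ε²)²`.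
    refine ⟨u * ε - (1 + 2 * ε) * v * ε ^ 2, u * ε ^ 2 + (1 + 2 * ε) * v * ε, ?_⟩
    have e : (u * ε - (1 + 2 * ε) * v * ε ^ 2) ^ 2 + (u * ε ^ 2 + (1 + 2 * ε) * v * ε) ^ 2
      = ((u : F) ^ 2 + (1 + 2 * ε) ^ 2 * v ^ 2) * (ε ^ 2 * (1 + ε ^ 2)) := by ring
    have e1 : (1 + 2 * ε) ^ 2 = -3 := by linear_combination 4 * hε1
    have e2 : ε ^ 2 * (1 + ε ^ 2) = -1 := by linear_combination (1 - ε + ε ^ 2) * hε1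
    rw [e, e1, e2, huv']
    ring
  obtain ⟨X, Y, Z, hne, hXYZ⟩ := exists_sq_sub_mul_sq_add_mul_sq_eq_zero hpq hs ht
  have hXYZ' : (X : F) ^ 2 - p * (Y : F) ^ 2 + q * (Z : F) ^ 2 = 0 := by
    exact_mod_cast congrArg (Int.cast : ℤ → F) hXYZ
  by_cases hB : B = 0
  · exact ⟨A, 1, 0, fun h => one_ne_zero h.2.1, by rw [hAB, hB]; ring⟩
  -- Product of `X + Y√p`, of norm `-qZ²`, and `A + √p`, of norm `-B²`.
  refine ⟨X * A + p * Y, X + A * Y, Z * B, ?_, ?_⟩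
  · rintro ⟨-, -, hZB⟩
    have hZ : Z = 0 := by simpa [hB] using hZB
    subst hZ
    have hXY : X ^ 2 = p * Y ^ 2 := by linarith
    rcases eq_or_ne Y 0 with rfl | hY
    · exact hne ⟨by simpa using hXY, rfl, rfl⟩
    · obtain ⟨k, rfl⟩ := (Int.pow_dvd_pow_iff two_ne_zero).1
        (show Y ^ 2 ∣ X ^ 2 from ⟨p, by rw [hXY, mul_comm]⟩)
      refine hp.out.int_sq_ne k (mul_left_cancel₀ (pow_ne_zero 2 hY) ?_)
      linarith
  · linear_combination (A ^ 2 - (p : F)) * hXYZ' + q * (Z : F) ^ 2 * hAB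

theorem normForm_anisotropic_of_legendreSym_eq_one {L : Type*} [Field L] [CharZero L] {ε r : L}
    (hε : IsPrimitiveRoot ε 3) {α : ℤ} (hα : α ≠ 0) (hr : r ^ 3 = (α : L)) {p q : ℕ}
    [hp : Fact p.Prime] (hp2 : p ≠ 2) (hqp : legendreSym p (q : ℤ) = -1)
    (h : legendreSym p (-3) = 1) (x y z w : ℚ⟮ε, r⟯)
    (h0 : x ^ 2 - p * y ^ 2 - q * z ^ 2 + p * q * w ^ 2 = 0) :
    x = 0 ∧ y = 0 ∧ z = 0 ∧ w = 0 := by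
  have hint : ∀ t ∈ ({ε, r} : Set L), IsIntegral ℚ t := by
    rintro t (rfl | rfl)
    · exact (hε.isIntegral (by norm_num)).tower_top
    · refine IsIntegral.of_pow (n := 3) (by norm_num) ?_
      rw [hr]
      simpa using isIntegral_algebraMap (R := ℚ) (A := L) (x := (α : ℚ))
  have : Algebra.IsAlgebraic ℚ ℚ⟮ε, r⟯ := IntermediateField.isAlgebraic_adjoin hint
  let Ω := AlgebraicClosure ℚ_[p]
  let f : ℚ⟮ε, r⟯ →ₐ[ℚ] Ω := IsAlgClosed.lift
  have hεK : ε ∈ ℚ⟮ε, r⟯ := IntermediateField.subset_adjoin _ _ (by simp)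
  have hrK : r ∈ ℚ⟮ε, r⟯ := IntermediateField.subset_adjoin _ _ (by simp)
  obtain ⟨ζ, hζ⟩ := Padic.exists_isPrimitiveRoot_three hp2 h
  have hεf : f ⟨ε, hεK⟩ ^ 3 = 1 := by
    rw [← map_pow, ← map_one f]
    exact congrArg f (Subtype.ext hε.pow_eq_one)
  have hrf : f ⟨r, hrK⟩ ^ 3 = algebraMap ℚ_[p] Ω (α : ℚ_[p]) := by
    rw [← map_pow, map_intCast, ← map_intCast f]
    exact congrArg f (Subtype.ext (by simpa using hr))
  -- The image of `ε` is a power of `ζ`, hence lies in `ℚ_p`; only `r` needs adjoining.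
  have hmem : ∀ t : ℚ⟮ε, r⟯, f t ∈ ℚ_[p]⟮f ⟨r, hrK⟩⟯ := by
    rintro ⟨t, ht⟩
    induction ht using IntermediateField.adjoin_induction with
    | mem t ht =>
      rcases ht with rfl | rfl
      · obtain ⟨i, -, hi⟩ := (hζ.map_of_injective
          (algebraMap ℚ_[p] Ω).injective).eq_pow_of_pow_eq_one hεf
        rw [← hi, ← map_pow]
        exact IntermediateField.algebraMap_mem _ _
      · exact IntermediateField.mem_adjoin_simple_self _ _
    | algebraMap c =>
      have e : f (algebraMap ℚ ℚ⟮ε, r⟯ c) = algebraMap ℚ_[p] Ω (c : ℚ_[p]) := by simp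
      exact e ▸ IntermediateField.algebraMap_mem _ _
    | add a b ha hb ha' hb' =>
      exact map_add f ⟨a, ha⟩ ⟨b, hb⟩ ▸ add_mem ha' hb'
    | mul a b ha hb ha' hb' =>
      exact map_mul f ⟨a, ha⟩ ⟨b, hb⟩ ▸ mul_mem ha' hb'
    | inv a ha ha' =>
      exact map_inv₀ f ⟨a, ha⟩ ▸ inv_mem ha'
  obtain ⟨h1, h2, h3, h4⟩ := normForm_anisotropic_adjoin_of_pow_three (Ω := Ω)
    (Padic.normForm_anisotropic hqp) hζ (Int.cast_ne_zero.2 hα) hrf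
    (hmem x) (hmem y) (hmem z) (hmem w) (by simpa using congrArg f h0)
  exact ⟨(map_eq_zero f).1 h1, (map_eq_zero f).1 h2, (map_eq_zero f).1 h3, (map_eq_zero f).1 h4⟩

theorem mainTheorem7 {L : Type*} [Field L] [CharZero L]
    (ε : L) (hε : IsPrimitiveRoot ε 3)
    (α : ℤ) (hα0 : α ≠ 0) (hα1 : α ≠ 1) (hα : IsCubeFree α)
    (r : L) (hr : r ^ 3 = (α : L))
    (K : IntermediateField ℚ L) (hK : K = ℚ⟮ε, r⟯)
    (p q : ℕ) [Fact p.Prime] [Fact q.Prime] (hpq : p ≠ q)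
    (hp : p % 4 = 3) (hq : q % 4 = 3) (hqp : legendreSym p (q : ℤ) ≠ 1) :
    IsDivisionAlgebra ℍ[K, (p : K), (q : K)] ↔ legendreSym p (-3) = 1 := by
  subst hK
  have hqp' : legendreSym p (q : ℤ) = -1 := by
    refine (legendreSym.eq_one_or_neg_one p ?_).resolve_left hqp
    rw [Int.cast_natCast, Ne, ZMod.natCast_eq_zero_iff]
    exact fun h => hpq ((Nat.prime_dvd_prime_iff_eq Fact.out Fact.out).1 h)
  refine ⟨fun hdiv => ?_, fun h => isDivisionAlgebra_quaternionAlgebra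
    (normForm_anisotropic_of_legendreSym_eq_one hε hα0 hr (by omega) hqp' h)⟩
  by_contra h
  have hεK : ε ∈ ℚ⟮ε, r⟯ := IntermediateField.subset_adjoin _ _ (by simp)
  have hε' : IsPrimitiveRoot (⟨ε, hεK⟩ : ℚ⟮ε, r⟯) 3 :=
    IsPrimitiveRoot.of_map_of_injective (f := algebraMap ℚ⟮ε, r⟯ L) hε
      (algebraMap ℚ⟮ε, r⟯ L).injective
  obtain ⟨x, y, z, hne, hxyz⟩ := exists_sq_sub_mul_sq_eq_mul_sq hε' hpq hp hq hqp' h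
  exact not_isDivisionAlgebra_quaternionAlgebra hxyz hne hdiv
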